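/- Let $p$ be a probability distribution of $(X,Y)$ on $\mathbb{R}^d\times\{-1,+1\}$ whose label marginals $p(y)=p(Y=y)$ are known, positive and unequal, $p(1)\neq p(-1)$. Fix $\theta\in\mathbb{R}^d$, put $f_\theta(x)=\sum_{j=1}^d\theta_jx_j$, and suppose that for $y\in\{-1,+1\}$ the conditional distribution of $f_\theta(X)$ given $Y=y$ is normal, $N(\mu_y^0,(\sigma_y^0)^2)$, with $\sigma^0_y>0$. Let $X^{(1)},X^{(2)},\ldots$ be i.i.d. with the distribution of $X$ (no labels are observed). For $\eta=(\mu_1,\mu_{-1},\sigma_1,\sigma_{-1})$ with $\sigma_1,\sigma_{-1}>0$ let $$\ell_n(\eta)=\sum_{i=1}^n\log\sum_{y\in\{-1,+1\}}p(y)\,N\bigl(f_\theta(X^{(i)});\mu_y,\sigma_y^2\bigr),$$ where $N(\cdot\,;\mu,\sigma^2)$ is the normal density. Let $E\subseteq\mathbb{R}^2\times(0,\infty)^2$ be a parameter set that contains the true value $\eta_0=(\mu_1^0,\mu_{-1}^0,\sigma_1^0,\sigma_{-1}^0)$ and on which the standard deviations are bounded away from zero: for some $\varepsilon>0$, $\sigma_1,\sigma_{-1}\ge\varepsilon$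 for all $\eta\in E$. (This includes every compact $E\subseteq\mathbb{R}^2\times(0,\infty)^2$ with $\eta_0\in E$, and the set $\mathbb{R}^2\times[\varepsilon,\infty)^2$ whenever $\varepsilon\le\min(\sigma^0_1,\sigma^0_{-1})$.) Then the maximum likelihood estimates over $E$ are strongly consistent: with probability $1$, every sequence $(\hat\eta_n)$ with $\hat\eta_n\in\operatorname{argmax}_{\eta\in E}\ell_n(\eta)$ for all sufficiently large $n$ satisfies $\hat\eta_n\to\eta_0$, that is, $(\hat\mu^{(n)}_1,\hat\mu^{(n)}_{-1},\hat\sigma^{(n)}_1,\hat\sigma^{(n)}_{-1})\to(\mu^0_1,\mu^0_{-1},\sigma^0_1,\sigma^0_{-1})$ as $n\to\infty$. Moreover, if $E$ is compact or $E=\mathbb{R}^2\times[\varepsilon,\infty)^2$, then $\operatorname{argmax}_{\eta\in E}\ell_n(\eta)$ is nonempty for every $n$ and every sample. -/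

import Mathlib

open MeasureTheory ProbabilityTheory Filter Topology

noncomputable section

namespace UnsupervisedMixture

/-- The binary labels `{-1, +1}`. -/
abbrev Label : Type := ℤˣ

/-- A parameter `η = (μ, σ)`: the means `η.1 y = μ_y` and the standard deviations `η.2 y = σ_y`,
for `y ∈ {-1, +1}`. -/
abbrev Param : Type := (Label → ℝ) × (Label → ℝ)

/-- The margin function `f_θ(x) = ∑ j, θ_j x_j` of a linear classifier. -/
def margin {d : ℕ} (θ x : Fin d → ℝ) : ℝ := ∑ j, θ j * x j

/-- The label marginal `p(Y = y)` of a joint distribution `p` of `(X, Y)`. -/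
def labelMarginal {d : ℕ} (p : Measure ((Fin d → ℝ) × Label)) (y : Label) : ℝ :=
  p.real {a | a.2 = y}

/-- The conditional distribution of `f_θ(X)` given `Y = y`, for `(X, Y)` distributed as `p`. -/
def condMarginLaw {d : ℕ} (p : Measure ((Fin d → ℝ) × Label)) (θ : Fin d → ℝ) (y : Label) :
    Measure ℝ :=
  (ProbabilityTheory.cond p {a | a.2 = y}).map (fun a => margin θ a.1)

/-- The Gaussian mixture density `∑ y, w_y N(z; μ_y, σ_y²)`. -/
def mixtureDensity (w : Label → ℝ) (η : Param) (z : ℝ) : ℝ :=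
  ∑ y, w y * gaussianPDFReal (η.1 y) (η.2 y ^ 2).toNNReal z

/-- The log-likelihood `ℓ_n(η)` of the first `n` terms of the data `z`. -/
def logLikelihood (w : Label → ℝ) (z : ℕ → ℝ) (n : ℕ) (η : Param) : ℝ :=
  ∑ i ∈ Finset.range n, Real.log (mixtureDensity w η (z i))

/-- The set of maximum likelihood estimates `argmax_{η ∈ E} ℓ_n(η)` over a parameter set `E`. -/
def mleSet (w : Label → ℝ) (z : ℕ → ℝ) (n : ℕ) (E : Set Param) : Set Param :=
  {η | η ∈ E ∧ IsMaxOn (logLikelihood w z n) E η}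

/-- The parameter set on which only the standard deviations are constrained, by `σ_y ≥ ε`. -/
def sigmaAtLeast (ε : ℝ) : Set Param :=
  {η | ∀ y, ε ≤ η.2 y}

end UnsupervisedMixture

end

/-! Strong consistency follows Wald's scheme, with square roots of likelihood ratios in place of
logarithms. Let f_η be the mixture density and f₀ the true one. A maximizer has a nonnegative sum of
log(f_η/f₀), and log x ≤ 2(√x - 1), so the sample mean of √(f_η/f₀) is at least 1
(`le_sum_sqrt_div_of_mem_mleSet`). Its expectation is the Hellinger affinity ∫ √(f_η f₀), which is
less than 1 unless η = η₀ (`integral_sqrt_mul_lt_one`). A law of large numbers uniform in η then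
forces convergence (`ae_tendsto_of_le_sum`).

Uniformity needs a compact parameter space. Since σ ≥ ε, each component density tends to 0, locally
uniformly in z, as its parameters leave compact sets. It therefore extends continuously by 0 to the
one-point compactification. Roots stay finite where a density vanishes, unlike logarithms, and they
are dominated by √(ε⁻¹/f₀), which is integrable against f₀ because √f₀ is Lebesgue integrable.

Identifiability, including mass lost at infinity, rests on linear independence of distinct normal
densities and on the unequal weights, which rule out label swapping (`eq_of_extMixture_eq`).
Existence over the noncompact set comes from clamping parameters to a box determined by the data
(`normalDensity_clamp_le`). -/

namespace UnsupervisedMixture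

/-! ### Normal densities: bounds, continuity, integrability -/

/-- The normal density with mean `c.1` and standard deviation `c.2`. -/
noncomputable def normalDensity (c : ℝ × ℝ) (z : ℝ) : ℝ :=
  gaussianPDFReal c.1 (c.2 ^ 2).toNNReal z

lemma normalDensity_nonneg (c : ℝ × ℝ) (z : ℝ) : 0 ≤ normalDensity c z :=
  gaussianPDFReal_nonneg _ _ _

lemma toNNReal_sq_ne_zero {s : ℝ} (hs : 0 < s) : (s ^ 2).toNNReal ≠ 0 :=
  (Real.toNNReal_pos.2 (by positivity)).ne'

lemma normalDensity_pos {c : ℝ × ℝ} (hc : 0 < c.2) (z : ℝ) : 0 < normalDensity c z :=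
  gaussianPDFReal_pos _ _ _ (toNNReal_sq_ne_zero hc)

lemma normalDensity_eq {c : ℝ × ℝ} (hc : 0 < c.2) (z : ℝ) :
    normalDensity c z =
      (√(2 * Real.pi))⁻¹ * (c.2⁻¹ * Real.exp (-(z - c.1) ^ 2 / (2 * c.2 ^ 2))) := by
  rw [normalDensity, gaussianPDFReal, Real.coe_toNNReal _ (by positivity),
    Real.sqrt_mul (by positivity), Real.sqrt_sq hc.le, mul_inv, mul_assoc]

lemma inv_sqrt_two_pi_le_one : (√(2 * Real.pi))⁻¹ ≤ 1 := by
  apply inv_le_one_of_one_le₀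
  rw [Real.one_le_sqrt]
  linarith [Real.pi_gt_three]

lemma normalDensity_mul_sigma_le {c : ℝ × ℝ} (hc : 0 < c.2) (z : ℝ) :
    normalDensity c z * c.2 ≤ 1 := by
  rw [normalDensity_eq hc]
  have h1 : Real.exp (-(z - c.1) ^ 2 / (2 * c.2 ^ 2)) ≤ 1 := by
    rw [Real.exp_le_one_iff, neg_div]
    have : 0 ≤ (z - c.1) ^ 2 / (2 * c.2 ^ 2) := by positivity
    linarith
  calc _ = (√(2 * Real.pi))⁻¹ * Real.exp (-(z - c.1) ^ 2 / (2 * c.2 ^ 2)) := by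
        field_simp
    _ ≤ 1 * 1 := by
        gcongr
        exact inv_sqrt_two_pi_le_one
    _ = 1 := one_mul 1

lemma mul_exp_neg_sq_half_le_one (t : ℝ) : t * Real.exp (-t ^ 2 / 2) ≤ 1 := by
  have h := Real.add_one_le_exp (t ^ 2 / 2)
  have h2 : t ≤ Real.exp (t ^ 2 / 2) := by nlinarith [sq_nonneg (t - 1)]
  rw [neg_div, Real.exp_neg, ← div_eq_mul_inv]
  exact (div_le_one (Real.exp_pos _)).2 h2

lemma normalDensity_mul_dist_le {c : ℝ × ℝ} (hc : 0 < c.2) (z : ℝ) :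
    normalDensity c z * |z - c.1| ≤ 1 := by
  rw [normalDensity_eq hc]
  have h := mul_exp_neg_sq_half_le_one (|z - c.1| / c.2)
  have e : -(z - c.1) ^ 2 / (2 * c.2 ^ 2) = -(|z - c.1| / c.2) ^ 2 / 2 := by
    rw [div_pow, sq_abs]
    field_simp
  rw [e]
  calc _ = (√(2 * Real.pi))⁻¹ *
        (|z - c.1| / c.2 * Real.exp (-(|z - c.1| / c.2) ^ 2 / 2)) := by ring
    _ ≤ 1 * 1 := by
        gcongr
        exact inv_sqrt_two_pi_le_one
    _ = 1 := one_mul 1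

/-- The sup norm of c is |c.1| or |c.2|, and the density is at most 1/|z - c.1| and 1/c.2. This
gives decay as c goes to infinity, uniform for bounded z. -/
lemma normalDensity_mul_norm_sub_le {c : ℝ × ℝ} (hc : 0 < c.2) (z : ℝ) :
    normalDensity c z * (‖c‖ - |z|) ≤ 1 := by
  have h0 := normalDensity_nonneg c z
  have h1 := normalDensity_mul_sigma_le hc z
  have h2 := normalDensity_mul_dist_le hc z
  rcases max_choice ‖c.1‖ ‖c.2‖ with h | h <;> rw [Prod.norm_def, h, Real.norm_eq_abs]
  · refine le_trans (mul_le_mul_of_nonneg_left ?_ h0) h2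
    have := abs_sub_abs_le_abs_sub c.1 z
    rwa [abs_sub_comm] at this
  · refine le_trans (mul_le_mul_of_nonneg_left ?_ h0) h1
    rw [abs_of_pos hc]
    linarith [abs_nonneg z]

lemma normalDensity_le_inv {c : ℝ × ℝ} {ε : ℝ} (hε : 0 < ε) (hc : ε ≤ c.2) (z : ℝ) :
    normalDensity c z ≤ ε⁻¹ := by
  have h := normalDensity_mul_sigma_le (hε.trans_le hc) z
  have h0 := normalDensity_nonneg c z
  rw [← one_div, le_div_iff₀ hε]
  exact le_trans (mul_le_mul_of_nonneg_left hc h0) h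

lemma continuousOn_normalDensity :
    ContinuousOn (fun q : (ℝ × ℝ) × ℝ => normalDensity q.1 q.2) {q | 0 < q.1.2} := by
  refine ContinuousOn.congr (f := fun q : (ℝ × ℝ) × ℝ => (√(2 * Real.pi))⁻¹ *
    (q.1.2⁻¹ * Real.exp (-(q.2 - q.1.1) ^ 2 / (2 * q.1.2 ^ 2)))) ?_
    (fun q hq => normalDensity_eq hq _)
  have h1 : ∀ q ∈ {q : (ℝ × ℝ) × ℝ | 0 < q.1.2}, q.1.2 ≠ 0 := fun q hq => ne_of_gt hq
  have h2 : ∀ q ∈ {q : (ℝ × ℝ) × ℝ | 0 < q.1.2}, 2 * q.1.2 ^ 2 ≠ 0 := fun q hq => by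
    have := h1 q hq
    positivity
  refine continuousOn_const.mul ((ContinuousOn.inv₀ (by fun_prop) h1).mul ?_)
  exact (ContinuousOn.div (by fun_prop) (by fun_prop) h2).rexp

lemma measurable_normalDensity (c : ℝ × ℝ) : Measurable (normalDensity c) :=
  measurable_gaussianPDFReal _ _

lemma integrable_normalDensity (c : ℝ × ℝ) : Integrable (normalDensity c) :=
  integrable_gaussianPDFReal _ _

lemma integral_normalDensity {c : ℝ × ℝ} (hc : 0 < c.2) : ∫ z, normalDensity c z = 1 :=
  integral_gaussianPDFReal_eq_one _ (toNNReal_sq_ne_zero hc)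

/-- The root of a normal density is a multiple of the normal density with the same mean and standard
deviation √2 σ. -/
lemma integrable_sqrt_normalDensity {c : ℝ × ℝ} (hc : 0 < c.2) :
    Integrable (fun z => √(normalDensity c z)) := by
  have hc' : 0 < (c.1, √2 * c.2).2 := by positivity
  have e : (fun z => √(normalDensity c z)) = fun z =>
      (√((√(2 * Real.pi))⁻¹ * c.2⁻¹) / ((√(2 * Real.pi))⁻¹ * (√2 * c.2)⁻¹)) *
        normalDensity (c.1, √2 * c.2) z := by
    ext z
    rw [normalDensity_eq hc, normalDensity_eq hc', ← mul_assoc, Real.sqrt_mul (by positivity),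
      ← Real.exp_half]
    have : -(z - c.1) ^ 2 / (2 * c.2 ^ 2) / 2
        = -(z - (c.1, √2 * c.2).1) ^ 2 / (2 * (c.1, √2 * c.2).2 ^ 2) := by
      simp only [mul_pow]
      rw [Real.sq_sqrt (by norm_num)]
      field_simp
    rw [this]
    simp only
    field_simp
  rw [e]
  exact (integrable_normalDensity _).const_mul _

/-- Projecting the mean to [-M, M] brings it closer to every z there, at distance at most 2M. With
the mean fixed, the density decreases in σ once σ exceeds that distance, so larger σ may be cut
down. -/
lemma normalDensity_clamp_le {c : ℝ × ℝ} {ε M z : ℝ} (hε : 0 < ε) (hc : ε ≤ c.2) (hM : 0 ≤ M)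
    (hz : |z| ≤ M) :
    normalDensity c z
      ≤ normalDensity (max (-M) (min c.1 M), min c.2 (max ε (2 * M))) z := by
  obtain ⟨m, s⟩ := c
  simp only at hc ⊢
  obtain ⟨hz1, hz2⟩ := abs_le.1 hz
  set m' := max (-M) (min m M) with hm'
  set s' := min s (max ε (2 * M)) with hs'
  have hs0 : 0 < s := hε.trans_le hc
  have hs'0 : 0 < s' := lt_min hs0 (hε.trans_le (le_max_left _ _))
  have hss : s' ≤ s := min_le_left _ _
  have hd : (z - m') ^ 2 ≤ (z - m) ^ 2 ∧ (z - m') ^ 2 ≤ (2 * M) ^ 2 := by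
    rcases le_total m M with h | h
    · rcases le_total (-M) m with h2 | h2
      · have : m' = m := by rw [hm', min_eq_left h, max_eq_right h2]
        rw [this]
        exact ⟨le_rfl, by apply sq_le_sq' <;> linarith⟩
      · have : m' = -M := by rw [hm', min_eq_left h, max_eq_left h2]
        rw [this]
        constructor <;> apply sq_le_sq' <;> linarith
    · have : m' = M := by rw [hm', min_eq_right h, max_eq_right (by linarith)]
      rw [this]
      exact ⟨by nlinarith, by apply sq_le_sq' <;> linarith⟩
  rw [normalDensity_eq (c := (m, s)) hs0, normalDensity_eq (c := (m', s')) hs'0]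
  simp only
  gcongr ?_ * ?_
  have h1 : Real.exp (-(z - m) ^ 2 / (2 * s ^ 2)) ≤ Real.exp (-(z - m') ^ 2 / (2 * s ^ 2)) := by
    rw [Real.exp_le_exp]
    exact div_le_div_of_nonneg_right (neg_le_neg hd.1) (by positivity)
  refine le_trans (mul_le_mul_of_nonneg_left h1 (by positivity)) ?_
  rcases le_total s (max ε (2 * M)) with h | h
  · rw [hs', min_eq_left h]
  -- the density decreases in the standard deviation beyond the distance to the mean
  have hs'e : s' = max ε (2 * M) := min_eq_right h
  have hD : (z - m') ^ 2 ≤ s' ^ 2 :=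
    hd.2.trans (pow_le_pow_left₀ (by linarith) (hs'e ▸ le_max_right _ _) 2)
  have hlog : s'/s * Real.exp ((z - m') ^ 2 / (2 * s' ^ 2) - (z - m') ^ 2 / (2 * s ^ 2)) ≤ 1 := by
    have hu : (z - m') ^ 2 / (2 * s' ^ 2) - (z - m') ^ 2 / (2 * s ^ 2)
        ≤ (1 - (s' / s) ^ 2) / 2 := by
      have : (z - m') ^ 2 / (2 * s' ^ 2) - (z - m') ^ 2 / (2 * s ^ 2)
        = ((z - m') ^ 2 / s' ^ 2) * ((1 - (s' / s) ^ 2) / 2) := by field_simp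
      rw [this]
      have h3 : s' / s ≤ 1 := (div_le_one hs0).2 hss
      have h4 : 0 ≤ s' / s := by positivity
      refine mul_le_of_le_one_left ?_ ((div_le_one (by positivity)).2 hD)
      nlinarith
    -- For r = s'/s: r ≤ (1 + r²)/2 = 1 - (1 - r²)/2 ≤ exp(-(1 - r²)/2).
    have h5 : s' / s ≤ Real.exp (-((1 - (s' / s) ^ 2) / 2)) := by
      have := Real.add_one_le_exp (-((1 - (s' / s) ^ 2) / 2))
      nlinarith [sq_nonneg (s' / s - 1)]
    calc _ ≤ Real.exp (-((1 - (s' / s) ^ 2) / 2)) * Real.exp ((1 - (s' / s) ^ 2) / 2) := by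
          gcongr
      _ = 1 := by rw [← Real.exp_add]; simp
  have e1 : Real.exp (-(z - m') ^ 2 / (2 * s ^ 2)) =
      Real.exp ((z - m') ^ 2 / (2 * s' ^ 2) - (z - m') ^ 2 / (2 * s ^ 2)) *
        Real.exp (-(z - m') ^ 2 / (2 * s' ^ 2)) := by
    rw [← Real.exp_add]; congr 1; ring
  rw [e1]
  calc _ = s'⁻¹ * ((s'/s * Real.exp ((z - m') ^ 2 / (2 * s' ^ 2) - (z - m') ^ 2 / (2 * s ^ 2))) *
        Real.exp (-(z - m') ^ 2 / (2 * s' ^ 2))) := by field_simp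
    _ ≤ _ := by
      gcongr
      exact mul_le_of_le_one_left (Real.exp_pos _).le hlog

/-! ### Linear independence of normal densities -/

lemma tendsto_quadratic_atBot {a b : ℝ} (e : ℝ) (h : a < 0 ∨ a = 0 ∧ b < 0) :
    Tendsto (fun z : ℝ => a * z ^ 2 + b * z + e) atTop atBot := by
  refine tendsto_atBot_add_const_right _ _ ?_
  rcases h with ha | ⟨rfl, hb⟩
  · have h1 : Tendsto (fun z : ℝ => z * (a * z + b)) atTop atBot :=
      tendsto_id.atTop_mul_atBot₀
        (tendsto_atBot_add_const_right _ _ (tendsto_id.const_mul_atTop_of_neg ha))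
    exact h1.congr fun z => by ring
  · exact (tendsto_id.const_mul_atTop_of_neg hb).congr fun z => by simp

/-- The logarithm of the ratio is quadratic in z; its leading coefficient is negative when c has the
smaller σ. For equal σ it is linear, with the sign of the difference of the means. -/
lemma tendsto_normalDensity_div {c c' : ℝ × ℝ} (hc : 0 < c.2) (hc' : 0 < c'.2)
    (h : c.2 < c'.2 ∨ c.2 = c'.2 ∧ c.1 < c'.1) :
    Tendsto (fun z => normalDensity c z / normalDensity c' z) atTop (𝓝 0) := by
  obtain ⟨m, s⟩ := c
  obtain ⟨m', s'⟩ := c'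
  simp only at hc hc' h
  have hq := tendsto_quadratic_atBot (a := 1 / (2 * s' ^ 2) - 1 / (2 * s ^ 2))
    (b := m / s ^ 2 - m' / s' ^ 2) (m' ^ 2 / (2 * s' ^ 2) - m ^ 2 / (2 * s ^ 2)) (by
      rcases h with h | ⟨rfl, h⟩
      · left
        rw [sub_neg]
        gcongr
      · right
        refine ⟨sub_self _, ?_⟩
        rw [sub_neg]
        gcongr)
  have h2 := (Real.tendsto_exp_atBot.comp hq).const_mul (s⁻¹ / s'⁻¹)
  rw [mul_zero] at h2
  refine h2.congr fun z => ?_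
  rw [normalDensity_eq (c := (m, s)) hc, normalDensity_eq (c := (m', s')) hc',
    mul_div_mul_left _ _ (by positivity), mul_div_mul_comm, ← Real.exp_sub,
    Function.comp_apply]
  congr 2
  field_simp
  ring

/-- Distinct normal densities are linearly independent. -/
lemma linearIndependent_normalDensity {ι : Type*} {c : ι → ℝ × ℝ} (hinj : Function.Injective c)
    (hpos : ∀ i, 0 < (c i).2) : LinearIndependent ℝ (fun i => normalDensity (c i)) := by
  classical
  rw [linearIndependent_iff']
  intro s a h
  replace h : ∀ z, ∑ i ∈ s, a i * normalDensity (c i) z = 0 := fun z => by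
    simpa using congrFun h z
  -- The component with lexicographically largest (σ, μ) dominates all others at +∞; dividing the
  -- relation by its density isolates its coefficient.
  induction s using Finset.induction_on_max_value (fun i => toLex ((c i).2, (c i).1)) with
  | empty => simp
  | insert b s hb hmax ih =>
    have key : a b = 0 := by
      have hlim : Tendsto (fun z => ∑ i ∈ insert b s,
          a i * (normalDensity (c i) z / normalDensity (c b) z)) atTop (𝓝 (a b)) := by
        simp only [Finset.sum_insert hb]
        have h1 : Tendsto (fun z => ∑ i ∈ s, a i * (normalDensity (c i) z / normalDensity (c b) z))
            atTop (𝓝 (∑ i ∈ s, a i * 0)) := by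
          refine tendsto_finsetSum _ fun i hi => Tendsto.const_mul _ ?_
          refine tendsto_normalDensity_div (hpos i) (hpos b) ?_
          have hle := hmax i hi
          rw [Prod.Lex.le_iff] at hle
          simp only [ofLex_toLex] at hle
          rcases hle with hle | ⟨h1, h2⟩
          · exact Or.inl hle
          · refine Or.inr ⟨h1, lt_of_le_of_ne h2 fun h3 => hb ?_⟩
            rwa [← hinj (Prod.ext h3 h1)]
        have h2 : Tendsto (fun z => a b * (normalDensity (c b) z / normalDensity (c b) z)) atTop
            (𝓝 (a b)) := by
          refine tendsto_const_nhds.congr fun z => ?_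
          rw [div_self (normalDensity_pos (hpos b) z).ne', mul_one]
        simpa using h2.add h1
      refine tendsto_nhds_unique hlim (tendsto_const_nhds.congr fun z => ?_)
      simp_rw [← mul_div_assoc, ← Finset.sum_div]
      rw [h z, zero_div]
    have h' : ∀ z, ∑ i ∈ s, a i * normalDensity (c i) z = 0 := fun z => by
      have := h z
      rwa [Finset.sum_insert hb, key, zero_mul, zero_add] at this
    intro i hi
    rcases Finset.mem_insert.1 hi with rfl | hi
    · exact key
    · exact ih h' i hi

/-! ### Existence of maximum likelihood estimates -/

lemma mixtureDensity_eq_sum (w : Label → ℝ) (η : Param) (z : ℝ) :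
    mixtureDensity w η z = ∑ y, w y * normalDensity (η.1 y, η.2 y) z := rfl

lemma mixtureDensity_pos {w : Label → ℝ} (hw : ∀ y, 0 < w y) {η : Param} (hη : ∀ y, 0 < η.2 y)
    (z : ℝ) : 0 < mixtureDensity w η z :=
  Finset.sum_pos (fun y _ => mul_pos (hw y) (normalDensity_pos (c := (η.1 y, η.2 y)) (hη y) z))
    Finset.univ_nonempty

lemma continuousOn_logLikelihood {w : Label → ℝ} (hw : ∀ y, 0 < w y) (z : ℕ → ℝ) (n : ℕ) :
    ContinuousOn (logLikelihood w z n) {η | ∀ y, 0 < η.2 y} := by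
  refine continuousOn_finsetSum _ fun i _ => ContinuousOn.log ?_
    fun η hη => (mixtureDensity_pos hw hη _).ne'
  refine continuousOn_finsetSum _ fun y _ => continuousOn_const.mul ?_
  exact continuousOn_normalDensity.comp (f := fun η : Param => ((η.1 y, η.2 y), z i))
    (by fun_prop) fun η hη => hη y

lemma mleSet_nonempty_of_isCompact {w : Label → ℝ} (hw : ∀ y, 0 < w y) (z : ℕ → ℝ) (n : ℕ)
    {ε : ℝ} (hε : 0 < ε) {E : Set Param} (hE : E ⊆ sigmaAtLeast ε) (hne : E.Nonempty)
    (hc : IsCompact E) : (mleSet w z n E).Nonempty := by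
  obtain ⟨η, hη, hmax⟩ := hc.exists_isMaxOn hne
    ((continuousOn_logLikelihood hw z n).mono fun η hη y => hε.trans_le (hE hη y))
  exact ⟨η, hη, hmax⟩

lemma mleSet_sigmaAtLeast_nonempty {w : Label → ℝ} (hw : ∀ y, 0 < w y) (z : ℕ → ℝ) (n : ℕ)
    {ε : ℝ} (hε : 0 < ε) : (mleSet w z n (sigmaAtLeast ε)).Nonempty := by
  obtain ⟨M, hM⟩ : ∃ M, ∀ i ∈ Finset.range n, |z i| ≤ M :=
    ((Finset.range n).image fun i => |z i|).exists_le.imp fun M h i hi =>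
      h _ (Finset.mem_image_of_mem _ hi)
  wlog hM0 : 0 ≤ M generalizing M
  · exact this (max M 0) (fun i hi => (hM i hi).trans (le_max_left _ _)) (le_max_right _ _)
  -- Clamping to means in [-M, M] and deviations in [ε, S] never lowers the likelihood, so a
  -- maximizer over this box is global.
  set S := max ε (2 * M)
  let K : Set Param :=
    (Set.univ.pi fun _ => Set.Icc (-M) M) ×ˢ (Set.univ.pi fun _ => Set.Icc ε S)
  have hK : IsCompact K :=
    (isCompact_univ_pi fun _ => isCompact_Icc).prod (isCompact_univ_pi fun _ => isCompact_Icc)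
  have hKsub : K ⊆ sigmaAtLeast ε := fun η hη y => (hη.2 y (Set.mem_univ _)).1
  have hKne : K.Nonempty := ⟨(fun _ => 0, fun _ => ε),
    fun _ _ => ⟨by simpa using hM0, hM0⟩, fun _ _ => ⟨le_rfl, le_max_left _ _⟩⟩
  obtain ⟨η, hη, hmax⟩ := mleSet_nonempty_of_isCompact hw z n hε hKsub hKne hK
  refine ⟨η, hKsub hη, fun η' hη' => ?_⟩
  let η'' : Param := (fun y => max (-M) (min (η'.1 y) M), fun y => min (η'.2 y) S)
  have hη'' : η'' ∈ K := by
    refine ⟨fun y _ => ⟨le_max_left _ _, max_le (by linarith) (min_le_right _ _)⟩,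
      fun y _ => ⟨le_min (hη' y) (le_max_left _ _), min_le_right _ _⟩⟩
  refine le_trans ?_ (isMaxOn_iff.1 hmax η'' hη'')
  refine Finset.sum_le_sum fun i hi => Real.log_le_log
    (mixtureDensity_pos hw (fun y => hε.trans_le (hη' y)) _) ?_
  refine Finset.sum_le_sum fun y _ => mul_le_mul_of_nonneg_left ?_ (hw y).le
  exact normalDensity_clamp_le (c := (η'.1 y, η'.2 y)) hε (hη' y) hM0 (hM i hi)

/-! ### Compactification of the parameter space -/

/-- The parameters of a single normal component with standard deviation at least `ε`. -/
abbrev Component (ε : ℝ) : Type := {c : ℝ × ℝ // ε ≤ c.2}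

/-- The normal density, extended by zero to the one-point compactification of its parameters. -/
noncomputable def extDensity {ε : ℝ} (c : OnePoint (Component ε)) (z : ℝ) : ℝ :=
  c.elim 0 fun c => normalDensity c z

/-- The mixture density on the compactified parameter space. -/
noncomputable def extMixture {ε : ℝ} (w : Label → ℝ) (ξ : Label → OnePoint (Component ε))
    (z : ℝ) : ℝ :=
  ∑ y, w y * extDensity (ξ y) z

lemma tendsto_norm_component (ε : ℝ) :
    Tendsto (fun c : Component ε => ‖c.1‖) (cocompact _) atTop :=
  tendsto_norm_cocompact_atTop.comp
    (IsClosed.isClosedEmbedding_subtypeVal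
      (isClosed_le continuous_const continuous_snd)).tendsto_cocompact

lemma continuous_extDensity {ε : ℝ} (hε : 0 < ε) :
    Continuous fun q : OnePoint (Component ε) × ℝ => extDensity q.1 q.2 := by
  rw [continuous_iff_continuousAt]
  rintro ⟨c, z₀⟩
  induction c using OnePoint.rec with
  | infty =>
    rw [ContinuousAt, nhds_prod_eq, Metric.tendsto_nhds]
    intro δ hδ
    have h1 : ∀ᶠ c : OnePoint (Component ε) in 𝓝 OnePoint.infty,
        ∀ z, |z| < |z₀| + 1 → extDensity c z < δ := by
      rw [OnePoint.nhds_infty_eq, eventually_sup, eventually_map, coclosedCompact_eq_cocompact]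
      refine ⟨?_, by simpa [extDensity] using fun _ _ => hδ⟩
      -- The threshold makes ‖c‖ - |z| > δ⁻¹ for all |z| < |z₀| + 1, hence the density less than δ.
      filter_upwards [(tendsto_norm_component ε).eventually_gt_atTop (|z₀| + 1 + δ⁻¹)]
        with c hc z hz
      have h2 := normalDensity_mul_norm_sub_le (hε.trans_le c.2) z
      have h3 : δ⁻¹ < ‖c.1‖ - |z| := by linarith
      change normalDensity c z < δ
      by_contra! h4
      have : δ * δ⁻¹ < normalDensity c z * (‖c.1‖ - |z|) :=
        mul_lt_mul' h4 h3 (by positivity) (hδ.trans_le h4)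
      rw [mul_inv_cancel₀ hδ.ne'] at this
      linarith
    have h2 : ∀ᶠ z in 𝓝 z₀, |z| < |z₀| + 1 :=
      (continuous_abs.tendsto z₀).eventually_lt_const (by linarith)
    filter_upwards [h1.prod_mk h2] with q hq
    have h0 : 0 ≤ extDensity q.1 q.2 := by
      obtain ⟨c, z⟩ := q
      induction c using OnePoint.rec with
      | infty => exact le_rfl
      | coe c => exact normalDensity_nonneg _ _
    change |extDensity q.1 q.2 - 0| < δ
    rw [sub_zero, abs_of_nonneg h0]
    exact hq.1 _ hq.2
  | coe c =>
    have he := (OnePoint.isOpenEmbedding_coe (X := Component ε)).prodMap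
      (Topology.IsOpenEmbedding.id (X := ℝ))
    refine (he.continuousAt_iff (x := (c, z₀))).1 (Continuous.continuousAt ?_)
    exact continuousOn_normalDensity.comp_continuous
      (f := fun q : Component ε × ℝ => (q.1.1, q.2)) (by fun_prop) fun q => hε.trans_le q.1.2

lemma extDensity_nonneg {ε : ℝ} (c : OnePoint (Component ε)) (z : ℝ) : 0 ≤ extDensity c z := by
  induction c using OnePoint.rec with
  | infty => exact le_rfl
  | coe c => exact normalDensity_nonneg _ _

lemma extDensity_le {ε : ℝ} (hε : 0 < ε) (c : OnePoint (Component ε)) (z : ℝ) :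
    extDensity c z ≤ ε⁻¹ := by
  induction c using OnePoint.rec with
  | infty => exact inv_nonneg.2 hε.le
  | coe c => exact normalDensity_le_inv hε c.2 z

lemma integrable_extDensity {ε : ℝ} (c : OnePoint (Component ε)) : Integrable (extDensity c) := by
  induction c using OnePoint.rec with
  | infty => exact integrable_zero _ _ _
  | coe c => exact integrable_normalDensity _

lemma integral_extDensity_le {ε : ℝ} (hε : 0 < ε) (c : OnePoint (Component ε)) :
    ∫ z, extDensity c z ≤ 1 := by
  induction c using OnePoint.rec with
  | infty => simp [extDensity]
  | coe c => exact (integral_normalDensity (hε.trans_le c.2)).le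

section Mixture

variable {ε : ℝ} {w : Label → ℝ}

lemma continuous_extMixture (hε : 0 < ε) :
    Continuous fun q : (Label → OnePoint (Component ε)) × ℝ => extMixture w q.1 q.2 := by
  refine continuous_finsetSum _ fun y _ => continuous_const.mul ?_
  exact (continuous_extDensity hε).comp
    (f := fun q : (Label → OnePoint (Component ε)) × ℝ => (q.1 y, q.2)) (by fun_prop)

lemma extMixture_nonneg (hw : ∀ y, 0 < w y) (ξ : Label → OnePoint (Component ε)) (z : ℝ) :
    0 ≤ extMixture w ξ z :=
  Finset.sum_nonneg fun y _ => mul_nonneg (hw y).le (extDensity_nonneg _ _)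

lemma extMixture_le (hε : 0 < ε) (hw : ∀ y, 0 < w y) (hw1 : ∑ y, w y = 1)
    (ξ : Label → OnePoint (Component ε)) (z : ℝ) : extMixture w ξ z ≤ ε⁻¹ :=
  calc _ ≤ ∑ y, w y * ε⁻¹ :=
        Finset.sum_le_sum fun y _ => mul_le_mul_of_nonneg_left (extDensity_le hε _ _) (hw y).le
    _ = ε⁻¹ := by rw [← Finset.sum_mul, hw1, one_mul]

lemma integrable_extMixture (ξ : Label → OnePoint (Component ε)) : Integrable (extMixture w ξ) :=
  integrable_finsetSum _ fun y _ => (integrable_extDensity (ξ y)).const_mul _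

lemma integral_extMixture_le (hε : 0 < ε) (hw : ∀ y, 0 < w y) (hw1 : ∑ y, w y = 1)
    (ξ : Label → OnePoint (Component ε)) : ∫ z, extMixture w ξ z ≤ 1 := by
  unfold extMixture
  rw [integral_finsetSum _ fun y _ => (integrable_extDensity (ξ y)).const_mul _]
  simp_rw [integral_const_mul]
  calc _ ≤ ∑ y, w y * 1 := Finset.sum_le_sum fun y _ =>
        mul_le_mul_of_nonneg_left (integral_extDensity_le hε _) (hw y).le
    _ = 1 := by simpa using hw1

/-! ### Identifiability and Hellinger affinity -/

open Classical in
/-- The mixing measure of a compactified parameter, without its mass at infinity. -/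
noncomputable def mixing (w : Label → ℝ) (ξ : Label → OnePoint (Component ε)) :
    Component ε →₀ ℝ :=
  ∑ y, (ξ y).elim 0 fun c => Finsupp.single c (w y)

open Classical in
lemma mixing_apply (ξ : Label → OnePoint (Component ε)) (c : Component ε) :
    mixing w ξ c = ∑ y, if ξ y = c then w y else 0 := by
  rw [mixing, Finsupp.finsetSum_apply]
  refine Finset.sum_congr rfl fun y _ => ?_
  induction ξ y using OnePoint.rec with
  | infty => simp
  | coe b => simp [Finsupp.single_apply]

lemma linearCombination_mixing (ξ : Label → OnePoint (Component ε)) :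
    Finsupp.linearCombination ℝ (fun c : Component ε => normalDensity c) (mixing w ξ)
      = extMixture w ξ := by
  ext z
  rw [mixing, map_sum, Finset.sum_apply]
  refine Finset.sum_congr rfl fun y _ => ?_
  induction ξ y using OnePoint.rec with
  | infty => simp [extDensity]
  | coe b => simp [extDensity]

/-- Two-component normal mixtures with known unequal weights are identifiable. -/
lemma eq_of_extMixture_eq (hε : 0 < ε) (hw : ∀ y, 0 < w y) (hne : w 1 ≠ w (-1))
    {ξ : Label → OnePoint (Component ε)} {c : Label → Component ε}
    (h : extMixture w ξ = extMixture w fun y => (c y : OnePoint (Component ε))) :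
    ξ = fun y => (c y : OnePoint (Component ε)) := by
  classical
  have hli := linearIndependent_normalDensity (c := ((↑) : Component ε → ℝ × ℝ))
    Subtype.val_injective fun c => hε.trans_le c.2
  rw [← linearCombination_mixing, ← linearCombination_mixing] at h
  -- Linear independence turns equality of densities into equality of the finite mixing measures,
  -- compared below at the atoms c 1 and c (-1).
  have hm := hli h
  have e : ∀ b : Component ε, _ := fun b => DFunLike.congr_fun hm b
  simp only [mixing_apply, UnitsInt.univ, OnePoint.coe_eq_coe] at e
  have e1 := e (c 1)
  have e2 := e (c (-1))
  have hl : (1 : Label) ≠ -1 := by decide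
  rw [Finset.sum_pair hl, Finset.sum_pair hl] at e1 e2
  have h1 := hw 1
  have h2 := hw (-1)
  suffices ξ 1 = c 1 ∧ ξ (-1) = c (-1) by
    ext1 y
    rcases Int.units_eq_one_or y with rfl | rfl
    exacts [this.1, this.2]
  -- If the atoms coincide, the common one carries the full mass, so both components of ξ lie there.
  -- Otherwise the atom c 1 has mass w 1, which ξ (-1) alone could supply only if w (-1) = w 1.
  by_cases hc : c 1 = c (-1)
  · rw [hc] at e1 ⊢
    simp only [if_true] at e1
    split_ifs at e1 with a b b
    · exact ⟨a, b⟩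
    all_goals linarith
  · simp only [if_true, hc, Ne.symm hc, if_false] at e1 e2
    by_cases a : ξ 1 = c 1
    · refine ⟨a, ?_⟩
      by_contra b
      rw [if_neg b, a] at e2
      simp only [OnePoint.coe_eq_coe, hc, if_false] at e2
      linarith
    · rw [if_neg a] at e1
      split_ifs at e1 with b
      · exact absurd (by linarith) hne
      · linarith

/-- The Hellinger affinity of distinct mixtures is less than one. -/
lemma integral_sqrt_mul_lt_one (hε : 0 < ε) (hw : ∀ y, 0 < w y) (hw1 : ∑ y, w y = 1)
    (hne : w 1 ≠ w (-1)) {ξ : Label → OnePoint (Component ε)} {c : Label → Component ε}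
    (h : ξ ≠ fun y => (c y : OnePoint (Component ε))) :
    ∫ z, √(extMixture w ξ z * extMixture w (fun y => (c y : OnePoint (Component ε))) z) < 1 := by
  set ξ₀ : Label → OnePoint (Component ε) := fun y => (c y : OnePoint (Component ε))
  have hcont : ∀ ξ : Label → OnePoint (Component ε), Continuous (extMixture w ξ) := fun ξ =>
    (continuous_extMixture hε).comp (f := fun z : ℝ => (ξ, z)) (by fun_prop)
  -- The gap between arithmetic and geometric mean is half a squared difference of roots. Both
  -- mixtures have integral at most 1, so affinity at least 1 forces this gap to vanish a.e., and
  -- everywhere by continuity.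
  have hid : ∀ z, (extMixture w ξ z + extMixture w ξ₀ z) / 2 -
      √(extMixture w ξ z * extMixture w ξ₀ z)
      = (√(extMixture w ξ z) - √(extMixture w ξ₀ z)) ^ 2 / 2 := fun z => by
    rw [sub_sq, Real.sq_sqrt (extMixture_nonneg hw _ _), Real.sq_sqrt (extMixture_nonneg hw _ _),
      Real.sqrt_mul (extMixture_nonneg hw _ _)]
    ring
  have hi1 : Integrable fun z => (extMixture w ξ z + extMixture w ξ₀ z) / 2 :=
    ((integrable_extMixture ξ).add (integrable_extMixture ξ₀)).div_const 2
  have hi2 : Integrable fun z => √(extMixture w ξ z * extMixture w ξ₀ z) := by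
    refine hi1.mono' ((hcont ξ).mul (hcont ξ₀)).sqrt.aestronglyMeasurable (.of_forall fun z => ?_)
    rw [Real.norm_of_nonneg (Real.sqrt_nonneg _)]
    have := hid z
    have h2 : 0 ≤ (√(extMixture w ξ z) - √(extMixture w ξ₀ z)) ^ 2 / 2 := by positivity
    linarith
  by_contra! hge
  have hle : ∫ z, (√(extMixture w ξ z) - √(extMixture w ξ₀ z)) ^ 2 / 2 ≤ 0 := by
    simp_rw [← hid]
    rw [integral_sub hi1 hi2, integral_div,
      integral_add (integrable_extMixture ξ) (integrable_extMixture ξ₀)]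
    have h1 := integral_extMixture_le hε hw hw1 ξ
    have h2 := integral_extMixture_le hε hw hw1 ξ₀
    linarith
  have hnn : 0 ≤ fun z => (√(extMixture w ξ z) - √(extMixture w ξ₀ z)) ^ 2 / 2 :=
    fun z => by positivity
  have hint : Integrable fun z => (√(extMixture w ξ z) - √(extMixture w ξ₀ z)) ^ 2 / 2 :=
    (hi1.sub hi2).congr (.of_forall hid)
  have hz := (integral_eq_zero_iff_of_nonneg hnn hint).1 (le_antisymm hle (integral_nonneg hnn))
  have hcd : Continuous fun z => (√(extMixture w ξ z) - √(extMixture w ξ₀ z)) ^ 2 / 2 :=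
    (((hcont ξ).sqrt.sub (hcont ξ₀).sqrt).pow 2).div_const 2
  rw [hcd.ae_eq_iff_eq volume continuous_zero] at hz
  refine h (eq_of_extMixture_eq hε hw hne (funext fun z => ?_))
  have h3 := congrFun hz z
  simp only [Pi.zero_apply, div_eq_zero_iff, OfNat.ofNat_ne_zero, or_false, ne_eq,
    not_false_eq_true, pow_eq_zero_iff, sub_eq_zero] at h3
  exact (Real.sqrt_inj (extMixture_nonneg hw _ _) (extMixture_nonneg hw _ _)).1 h3

/-- Subadditivity of the square root reduces this to single components. -/
lemma integrable_sqrt_extMixture (hε : 0 < ε) (hw : ∀ y, 0 < w y) (c : Label → Component ε) :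
    Integrable fun z => √(extMixture w (fun y => (c y : OnePoint (Component ε))) z) := by
  have hcont : Continuous (extMixture w fun y => (c y : OnePoint (Component ε))) :=
    (continuous_extMixture hε).comp
      (f := fun z : ℝ => ((fun y => (c y : OnePoint (Component ε))), z)) (by fun_prop)
  refine (((integrable_sqrt_normalDensity (hε.trans_le (c 1).2)).const_mul √(w 1)).add
    ((integrable_sqrt_normalDensity (hε.trans_le (c (-1)).2)).const_mul √(w (-1)))).mono'
    hcont.sqrt.aestronglyMeasurable (.of_forall fun z => ?_)
  have hl : (1 : Label) ≠ -1 := by decide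
  rw [Real.norm_of_nonneg (Real.sqrt_nonneg _), extMixture, UnitsInt.univ, Finset.sum_pair hl,
    Pi.add_apply, ← Real.sqrt_mul (hw _).le, ← Real.sqrt_mul (hw _).le]
  have h : ∀ y, 0 ≤ w y * extDensity (c y : OnePoint (Component ε)) z := fun y =>
    mul_nonneg (hw y).le (extDensity_nonneg _ _)
  have hs : ∀ y, √(w y * extDensity (c y : OnePoint (Component ε)) z) ^ 2 = _ := fun y =>
    Real.sq_sqrt (h y)
  refine Real.sqrt_le_iff.2 ⟨add_nonneg (Real.sqrt_nonneg _) (Real.sqrt_nonneg _), ?_⟩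
  rw [← hs 1, ← hs (-1), add_sq]
  have := mul_nonneg (Real.sqrt_nonneg (w 1 * extDensity (c 1 : OnePoint (Component ε)) z))
    (Real.sqrt_nonneg (w (-1) * extDensity (c (-1) : OnePoint (Component ε)) z))
  change _ ≤ √(w 1 * extDensity (c 1 : OnePoint (Component ε)) z) ^ 2 +
    2 * √(w 1 * extDensity (c 1 : OnePoint (Component ε)) z) *
      √(w (-1) * extDensity (c (-1) : OnePoint (Component ε)) z) +
    √(w (-1) * extDensity (c (-1) : OnePoint (Component ε)) z) ^ 2
  linarith

end Mixture

/-! ### Uniform law of large numbers and consistency -/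

/-- Consistency of approximate maximizers of sample means over a compact parameter space. -/
lemma ae_tendsto_of_le_sum {Θ Ω : Type*} [TopologicalSpace Θ] [CompactSpace Θ]
    [MeasurableSpace Ω] {P : Measure Ω} [IsProbabilityMeasure P] {Z : ℕ → Ω → ℝ}
    (hZ : ∀ i, Measurable (Z i)) (hindep : Pairwise fun i j => IndepFun (Z i) (Z j) P)
    {ν : Measure ℝ} (hlaw : ∀ i, P.map (Z i) = ν) {h : Θ × ℝ → ℝ} (hcont : Continuous h)
    {g : ℝ → ℝ} (hg : Integrable g ν) (hg0 : ∀ z, 0 ≤ g z) (hgh : ∀ θ z, |h (θ, z)| ≤ g z)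
    {θ₀ : Θ} (hlt : ∀ θ, θ ≠ θ₀ → ∫ z, h (θ, z) ∂ν < 1) :
    ∀ᵐ ω ∂P, ∀ θ : ℕ → Θ,
      (∀ᶠ n : ℕ in atTop, (n : ℝ) ≤ ∑ i ∈ Finset.range n, h (θ n, Z i ω)) →
      Tendsto θ atTop (𝓝 θ₀) := by
  borelize C(Θ, ℝ)
  -- Each observation becomes a random element of the Banach space C(Θ, ℝ); the strong law there is
  -- convergence of sample means uniformly in θ.
  let H : C(ℝ, C(Θ, ℝ)) := ContinuousMap.curry ⟨fun q : ℝ × Θ => h (q.2, q.1), by fun_prop⟩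
  have hHapp : ∀ z θ, H z θ = h (θ, z) := fun _ _ => rfl
  have hHm : Measurable H := H.continuous.measurable
  have hHint : Integrable H ν := by
    refine hg.mono' H.continuous.stronglyMeasurable.aestronglyMeasurable (.of_forall fun z => ?_)
    rw [ContinuousMap.norm_le _ (hg0 z)]
    exact fun θ => hgh θ z
  have hint : Integrable (fun ω => H (Z 0 ω)) P := by
    rw [← hlaw 0] at hHint
    exact hHint.comp_measurable (hZ 0)
  have hmean : ∀ θ, (∫ ω, H (Z 0 ω) ∂P) θ = ∫ z, h (θ, z) ∂ν := fun θ => by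
    rw [ContinuousMap.integral_apply hint, ← hlaw 0, integral_map (hZ 0).aemeasurable]
    · rfl
    · exact (hcont.comp (by fun_prop : Continuous fun z : ℝ => (θ, z))).aestronglyMeasurable
  have hslln := strong_law_ae (μ := P) (fun i ω => H (Z i ω)) hint
    (fun i j hij => (hindep hij).comp hHm hHm)
    (fun i => IdentDistrib.comp ⟨(hZ i).aemeasurable, (hZ 0).aemeasurable,
      (hlaw i).trans (hlaw 0).symm⟩ hHm)
  filter_upwards [hslln] with ω hω θ hθ
  set Hbar := ∫ ω, H (Z 0 ω) ∂P
  rw [tendsto_nhds]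
  intro U hU hmem
  rcases (Uᶜ).eq_empty_or_nonempty with hne | hne
  · exact Eventually.of_forall fun n => by simp [Set.compl_empty_iff.1 hne]
  -- By compactness the limit stays below 1 by a fixed gap off U. Sample means uniformly closer than
  -- this gap cannot reach 1 there.
  obtain ⟨b, hb, hmax⟩ := hU.isClosed_compl.isCompact.exists_isMaxOn hne
    Hbar.continuous.continuousOn
  have hb1 : Hbar b < 1 := by
    rw [hmean]
    exact hlt b fun h => hb (h ▸ hmem)
  filter_upwards [hθ, (Metric.tendsto_nhds.1 hω) (1 - Hbar b) (by linarith),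
    eventually_gt_atTop 0] with n h1 h2 hn
  by_contra h3
  have h4 : Hbar (θ n) ≤ Hbar b := isMaxOn_iff.1 hmax _ h3
  have h5 := (ContinuousMap.dist_apply_le_dist (θ n)).trans_lt h2
  rw [ContinuousMap.smul_apply, ContinuousMap.sum_apply, smul_eq_mul, Real.dist_eq] at h5
  simp only [hHapp] at h5
  have h6 : 1 ≤ (n : ℝ)⁻¹ * ∑ i ∈ Finset.range n, h (θ n, Z i ω) := by
    have hn' : (0 : ℝ) < n := by exact_mod_cast hn
    rw [← div_eq_inv_mul, le_div_iff₀ hn', one_mul]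
    exact h1
  have h7 := (abs_lt.1 h5).2
  linarith

/-! ### Law of the unlabeled margin -/

instance measurableSingletonClassLabel : MeasurableSingletonClass Label :=
  ⟨fun y => ⟨{(y : ℤ)}, measurableSet_singleton _, by ext u; simp [Units.ext_iff]⟩⟩

lemma sum_labelMarginal {d : ℕ} (p : Measure ((Fin d → ℝ) × Label)) [IsProbabilityMeasure p] :
    ∑ y, labelMarginal p y = 1 := by
  have h := sum_meas_smul_cond_fiber (X := Prod.snd) measurable_snd p
  have h1 := congrArg (fun m : Measure ((Fin d → ℝ) × Label) => m Set.univ) h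
  have h2 : ∑ y, p {a | a.2 = y} = 1 := by
    rw [← measure_univ (μ := p), ← h1]
    simp only [Measure.coe_finsetSum, Finset.sum_apply, Measure.smul_apply, smul_eq_mul]
    refine Finset.sum_congr rfl fun y _ => ?_
    by_cases hy : p (Prod.snd ⁻¹' {y}) = 0
    · rw [hy, zero_mul]
      exact hy
    · have := cond_isProbabilityMeasure hy
      rw [measure_univ, mul_one]
      rfl
  simp only [labelMarginal, Measure.real]
  rw [← ENNReal.toReal_sum fun y _ => measure_ne_top _ _, h2, ENNReal.toReal_one]

lemma measurable_margin {d : ℕ} (θ : Fin d → ℝ) : Measurable (margin θ) := by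
  unfold margin
  fun_prop

/-- The margin of an unlabeled observation is distributed as the normal mixture. -/
lemma map_margin_eq_withDensity {d : ℕ} (p : Measure ((Fin d → ℝ) × Label))
    [IsProbabilityMeasure p] (θ : Fin d → ℝ) {η₀ : Param} (hpos : ∀ y, 0 < η₀.2 y)
    (hnormal : ∀ y, condMarginLaw p θ y = gaussianReal (η₀.1 y) (η₀.2 y ^ 2).toNNReal) :
    (p.map Prod.fst).map (margin θ)
      = volume.withDensity fun z => ENNReal.ofReal (mixtureDensity (labelMarginal p) η₀ z) := by
  ext s hs
  have hm : Measurable fun a : (Fin d → ℝ) × Label => margin θ a.1 :=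
    (measurable_margin θ).comp measurable_fst
  rw [withDensity_apply _ hs, Measure.map_map (measurable_margin θ) measurable_fst,
    Measure.map_apply ((measurable_margin θ).comp measurable_fst) hs]
  have h := sum_meas_smul_cond_fiber (X := Prod.snd) measurable_snd p
  calc p ((fun a => margin θ a.1) ⁻¹' s)
      = ∑ y, p {a | a.2 = y} * condMarginLaw p θ y s := by
        conv_lhs => rw [← h]
        simp only [Measure.coe_finsetSum, Finset.sum_apply, Measure.smul_apply, smul_eq_mul]
        refine Finset.sum_congr rfl fun y _ => ?_
        rw [condMarginLaw, Measure.map_apply hm hs]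
        rfl
    _ = ∑ y, ∫⁻ z in s, ENNReal.ofReal
          (labelMarginal p y * normalDensity (η₀.1 y, η₀.2 y) z) := by
        refine Finset.sum_congr rfl fun y _ => ?_
        have h0 : 0 ≤ labelMarginal p y := measureReal_nonneg
        simp_rw [ENNReal.ofReal_mul h0]
        rw [lintegral_const_mul _ (measurable_normalDensity _).ennreal_ofReal, hnormal,
          gaussianReal_apply _ (toNNReal_sq_ne_zero (hpos y)), labelMarginal, ofReal_measureReal]
        rfl
    _ = _ := by
        rw [← lintegral_finsetSum _ fun y _ =>
          ((measurable_normalDensity _).const_mul _).ennreal_ofReal]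
        refine lintegral_congr fun z => ?_
        have h0 : ∀ y, 0 ≤ labelMarginal p y := fun _ => measureReal_nonneg
        rw [mixtureDensity_eq_sum, ENNReal.ofReal_sum_of_nonneg fun y _ =>
          mul_nonneg (h0 y) (normalDensity_nonneg _ _)]

/-! ### From maximum likelihood to consistency -/

lemma log_le_two_mul_sqrt_sub_one {x : ℝ} (hx : 0 < x) : Real.log x ≤ 2 * (√x - 1) := by
  have := Real.log_le_sub_one_of_pos (Real.sqrt_pos.2 hx)
  rw [Real.log_sqrt hx.le] at this
  linarith

lemma le_sum_sqrt_div_of_mem_mleSet {w : Label → ℝ} (hw : ∀ y, 0 < w y) {z : ℕ → ℝ} {n : ℕ}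
    {ε : ℝ} (hε : 0 < ε) {E : Set Param} (hE : E ⊆ sigmaAtLeast ε) {η η₀ : Param} (hη₀ : η₀ ∈ E)
    (hη : η ∈ mleSet w z n E) :
    (n : ℝ) ≤ ∑ i ∈ Finset.range n, √(mixtureDensity w η (z i) / mixtureDensity w η₀ (z i)) := by
  have hp : ∀ i, 0 < mixtureDensity w η (z i) := fun i =>
    mixtureDensity_pos hw (fun y => hε.trans_le (hE hη.1 y)) _
  have hp₀ : ∀ i, 0 < mixtureDensity w η₀ (z i) := fun i =>
    mixtureDensity_pos hw (fun y => hε.trans_le (hE hη₀ y)) _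
  have h1 : logLikelihood w z n η₀ ≤ logLikelihood w z n η := isMaxOn_iff.1 hη.2 η₀ hη₀
  have h2 : ∑ i ∈ Finset.range n,
      Real.log (mixtureDensity w η (z i) / mixtureDensity w η₀ (z i)) ≤ ∑ i ∈ Finset.range n,
        2 * (√(mixtureDensity w η (z i) / mixtureDensity w η₀ (z i)) - 1) :=
    Finset.sum_le_sum fun i _ => log_le_two_mul_sqrt_sub_one (div_pos (hp i) (hp₀ i))
  simp_rw [Real.log_div (hp _).ne' (hp₀ _).ne'] at h2
  rw [Finset.sum_sub_distrib, ← Finset.mul_sum, Finset.sum_sub_distrib, Finset.sum_const,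
    Finset.card_range, nsmul_eq_mul, mul_one] at h2
  unfold logLikelihood at h1
  linarith

open Classical in
/-- The point of the compactified parameter space that represents a parameter. -/
noncomputable def toExt (ε : ℝ) (η : Param) (y : Label) : OnePoint (Component ε) :=
  -- The value at infinity is a default: estimates lie in `sigmaAtLeast ε` for all large n, and
  -- earlier terms do not affect limits.
  if h : ε ≤ η.2 y then ((⟨(η.1 y, η.2 y), h⟩ : Component ε) : OnePoint (Component ε))
  else OnePoint.infty

lemma toExt_of_mem {ε : ℝ} {η : Param} (hη : η ∈ sigmaAtLeast ε) (y : Label) :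
    toExt ε η y = ((⟨(η.1 y, η.2 y), hη y⟩ : Component ε) : OnePoint (Component ε)) :=
  dif_pos (hη y)

lemma extMixture_toExt {ε : ℝ} (w : Label → ℝ) {η : Param} (hη : η ∈ sigmaAtLeast ε) (z : ℝ) :
    extMixture w (toExt ε η) z = mixtureDensity w η z := by
  rw [extMixture, mixtureDensity_eq_sum]
  refine Finset.sum_congr rfl fun y _ => ?_
  rw [toExt_of_mem hη]
  rfl

/-- The finite parameters are openly embedded in the compactification, so convergence to a finite
point there is ordinary convergence. -/
lemma tendsto_of_tendsto_toExt {ε : ℝ} {η : ℕ → Param} {η₀ : Param}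
    (hη₀ : η₀ ∈ sigmaAtLeast ε) (hη : ∀ᶠ n in atTop, η n ∈ sigmaAtLeast ε)
    (h : Tendsto (fun n => toExt ε (η n)) atTop (𝓝 (toExt ε η₀))) :
    Tendsto η atTop (𝓝 η₀) := by
  have key : ∀ y, Tendsto (fun n => ((η n).1 y, (η n).2 y)) atTop (𝓝 (η₀.1 y, η₀.2 y)) := by
    intro y
    let F : OnePoint (Component ε) → ℝ × ℝ := fun c => c.elim 0 Subtype.val
    have hF : ContinuousAt F (toExt ε η₀ y) := by
      rw [toExt_of_mem hη₀]
      exact OnePoint.isOpenEmbedding_coe.continuousAt_iff.1 continuous_subtype_val.continuousAt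
    have h1 := hF.tendsto.comp (tendsto_pi_nhds.1 h y)
    have h2 : F (toExt ε η₀ y) = (η₀.1 y, η₀.2 y) := by rw [toExt_of_mem hη₀]; rfl
    rw [h2] at h1
    refine h1.congr' (hη.mono fun n hn => ?_)
    rw [Function.comp_apply, toExt_of_mem hn]
    rfl
  have h1 : Tendsto (fun n => (η n).1) atTop (𝓝 η₀.1) :=
    tendsto_pi_nhds.2 fun y => (key y).fst_nhds
  have h2 : Tendsto (fun n => (η n).2) atTop (𝓝 η₀.2) :=
    tendsto_pi_nhds.2 fun y => (key y).snd_nhds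
  exact h1.prodMk_nhds h2

/-- Strong consistency of the maximum likelihood estimates for an i.i.d. sample of a two-component
normal mixture. -/
lemma ae_tendsto_of_mem_mleSet {w : Label → ℝ} (hw : ∀ y, 0 < w y) (hw1 : ∑ y, w y = 1)
    (hne : w 1 ≠ w (-1)) {Ω : Type*} [MeasurableSpace Ω] {P : Measure Ω} [IsProbabilityMeasure P]
    {Z : ℕ → Ω → ℝ} (hZ : ∀ i, Measurable (Z i))
    (hindep : Pairwise fun i j => IndepFun (Z i) (Z j) P) {η₀ : Param}
    (hlaw : ∀ i, P.map (Z i)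
      = volume.withDensity fun z => ENNReal.ofReal (mixtureDensity w η₀ z))
    {ε : ℝ} (hε : 0 < ε) {E : Set Param} (hE : E ⊆ sigmaAtLeast ε) (hη₀ : η₀ ∈ E) :
    ∀ᵐ ω ∂P, ∀ η : ℕ → Param, (∀ᶠ n in atTop, η n ∈ mleSet w (fun i => Z i ω) n E) →
      Tendsto η atTop (𝓝 η₀) := by
  set f₀ := mixtureDensity w η₀ with hf₀
  have hpos : ∀ z, 0 < f₀ z := mixtureDensity_pos hw fun y => hε.trans_le (hE hη₀ y)
  have hext : ∀ z, extMixture w (toExt ε η₀) z = f₀ z := extMixture_toExt w (hE hη₀)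
  have hcoe : toExt ε η₀ = fun y =>
      ((⟨(η₀.1 y, η₀.2 y), hE hη₀ y⟩ : Component ε) : OnePoint (Component ε)) :=
    funext fun y => toExt_of_mem (hE hη₀) y
  have hf₀c : Continuous f₀ := by
    have : f₀ = fun z => extMixture w (toExt ε η₀) z := (funext hext).symm
    rw [this]
    exact (continuous_extMixture hε).comp (f := fun z : ℝ => (toExt ε η₀, z)) (by fun_prop)
  have hdm : Measurable fun z => ENNReal.ofReal (f₀ z) := hf₀c.measurable.ennreal_ofReal
  let h : (Label → OnePoint (Component ε)) × ℝ → ℝ := fun q => √(extMixture w q.1 q.2 / f₀ q.2)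
  have hcont : Continuous h :=
    ((continuous_extMixture hε).div (by fun_prop) fun q => (hpos _).ne').sqrt
  -- Against f₀ the envelope √(ε⁻¹/f₀) becomes √ε⁻¹ √f₀.
  have hg : Integrable (fun z => √(ε⁻¹ / f₀ z))
      (volume.withDensity fun z => ENNReal.ofReal (f₀ z)) := by
    rw [integrable_withDensity_iff hdm (.of_forall fun _ => ENNReal.ofReal_lt_top)]
    have hs := (integrable_sqrt_extMixture hε hw fun y =>
      (⟨(η₀.1 y, η₀.2 y), hE hη₀ y⟩ : Component ε)).const_mul √ε⁻¹
    refine hs.congr (.of_forall fun z => ?_)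
    simp only
    rw [← hcoe, hext, ENNReal.toReal_ofReal (hpos z).le, Real.sqrt_div (inv_nonneg.2 hε.le),
      div_mul_eq_mul_div, mul_div_assoc, Real.div_sqrt]
  have hgh : ∀ ξ z, |h (ξ, z)| ≤ √(ε⁻¹ / f₀ z) := fun ξ z => by
    rw [abs_of_nonneg (Real.sqrt_nonneg _)]
    exact Real.sqrt_le_sqrt (div_le_div_of_nonneg_right (extMixture_le hε hw hw1 ξ z) (hpos z).le)
  have hlt : ∀ ξ, ξ ≠ toExt ε η₀ →
      ∫ z, h (ξ, z) ∂(volume.withDensity fun z => ENNReal.ofReal (f₀ z)) < 1 := fun ξ hξ => by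
    rw [integral_withDensity_eq_integral_toReal_smul hdm
      (.of_forall fun _ => ENNReal.ofReal_lt_top)]
    rw [hcoe] at hξ
    have := integral_sqrt_mul_lt_one hε hw hw1 hne hξ
    rw [← hcoe] at this
    refine lt_of_eq_of_lt (integral_congr_ae (.of_forall fun z => ?_)) this
    simp only [h, smul_eq_mul]
    rw [hext, ENNReal.toReal_ofReal (hpos z).le, Real.sqrt_div (extMixture_nonneg hw _ _),
      Real.sqrt_mul (extMixture_nonneg hw _ _), mul_div_left_comm, Real.div_sqrt]
  filter_upwards [ae_tendsto_of_le_sum hZ hindep hlaw hcont hg (fun z => Real.sqrt_nonneg _)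
    hgh hlt] with ω hω η hη
  refine tendsto_of_tendsto_toExt (hE hη₀) (hη.mono fun n hn => hE hn.1) (hω _ ?_)
  filter_upwards [hη] with n hn
  simp only [h, extMixture_toExt w (hE hn.1)]
  exact le_sum_sqrt_div_of_mem_mleSet hw hε hE hη₀ hn

end UnsupervisedMixture

theorem mainTheorem3 {d : ℕ}
    -- the joint distribution of `(X, Y)`, with known unequal label marginals
    (p : Measure ((Fin d → ℝ) × UnsupervisedMixture.Label)) [IsProbabilityMeasure p]
    (hw_pos : ∀ y, 0 < UnsupervisedMixture.labelMarginal p y)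
    (hw_ne : UnsupervisedMixture.labelMarginal p 1 ≠ UnsupervisedMixture.labelMarginal p (-1))
    -- `f_θ(X)` given `Y = y` is normal; `η₀` collects the true means and standard deviations
    (θ : Fin d → ℝ) (η₀ : UnsupervisedMixture.Param)
    (hnormal : ∀ y, UnsupervisedMixture.condMarginLaw p θ y
      = gaussianReal (η₀.1 y) (η₀.2 y ^ 2).toNNReal)
    -- the unlabeled sample
    {Ω : Type*} [MeasurableSpace Ω] (P : Measure Ω) [IsProbabilityMeasure P]
    (X : ℕ → Ω → (Fin d → ℝ)) (hX_meas : ∀ i, Measurable (X i))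
    (hX_indep : iIndepFun X P) (hX_law : ∀ i, P.map (X i) = p.map Prod.fst)
    -- the parameter set: standard deviations bounded away from zero, true parameter included
    (ε : ℝ) (hε : 0 < ε) (E : Set UnsupervisedMixture.Param)
    (hE : E ⊆ UnsupervisedMixture.sigmaAtLeast ε) (hη₀ : η₀ ∈ E) :
    ((IsCompact E ∨ E = UnsupervisedMixture.sigmaAtLeast ε) →
      ∀ n ω, (UnsupervisedMixture.mleSet (UnsupervisedMixture.labelMarginal p)
        (fun i => UnsupervisedMixture.margin θ (X i ω)) n E).Nonempty) ∧
    ∀ᵐ ω ∂P, ∀ ηhat : ℕ → UnsupervisedMixture.Param,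
      (∀ᶠ n in atTop, ηhat n ∈ UnsupervisedMixture.mleSet (UnsupervisedMixture.labelMarginal p)
        (fun i => UnsupervisedMixture.margin θ (X i ω)) n E) →
      Tendsto ηhat atTop (𝓝 η₀) := by
  refine ⟨fun h n ω => ?_, ?_⟩
  · rcases h with h | rfl
    · exact UnsupervisedMixture.mleSet_nonempty_of_isCompact hw_pos _ n hε hE ⟨η₀, hη₀⟩ h
    · exact UnsupervisedMixture.mleSet_sigmaAtLeast_nonempty hw_pos _ n hε
  · have hm := UnsupervisedMixture.measurable_margin θ
    refine UnsupervisedMixture.ae_tendsto_of_mem_mleSet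
      (Z := fun i ω => UnsupervisedMixture.margin θ (X i ω)) hw_pos
      (UnsupervisedMixture.sum_labelMarginal p) hw_ne (fun i => hm.comp (hX_meas i))
      (fun i j hij => (hX_indep.indepFun hij).comp hm hm) (fun i => ?_) hε hE hη₀
    rw [← UnsupervisedMixture.map_margin_eq_withDensity p θ (fun y => hε.trans_le (hE hη₀ y))
      hnormal, ← hX_law i, Measure.map_map hm (hX_meas i)]
    rfl
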